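/- Let $n\ge 1$, let $\Omega\subset\mathbb{R}^n$ be a non-empty, bounded, open and convex set, and let $U$ be an open set with $\bar U\subset\Omega$. Put $K=\bar\Omega\setminus U$. Let $f:\bar\Omega\to\mathbb{R}$ be continuous, let $\tilde f$ be any bounded uniformly continuous extension of $f$ to $\mathbb{R}^n$, let $\omega_{\tilde f}(t)=\sup\{|\tilde f(x)-\tilde f(y)|:\ |x-y|\le t\}$ be its modulus of continuity and let $\omega$ be the least concave majorant of $\omega_{\tilde f}$ on $[0,\infty)$. Let $a,b\ge 0$ be such that $\omega(t)\le at+b$ for all $t\ge 0$, and let $A_0$ be such that $|f(x)|\le A_0$ for all $x\in K$. For $M>0$ define $$f_K^{M,\infty}(x)=\begin{cases} f(x), & x\in K,\\ M, & x\in U,\\ +\infty, & x\in\mathbb{R}^n\setminus\bar\Omega,\end{cases}\qquad f_K^{-M,-\infty}(x)=\begin{cases} f(x), & x\in K,\\ -M, & x\in U,\\ -\infty, & x\in\mathbb{R}^n\setminus\bar\Omega.\end{cases}$$ For $\lambda>0$ let $C^l_\lambda(g)(x)=\mathrm{co}[\lambda|\cdot|^2+g](x)-\lambda|x|^2$ and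 $C^u_\lambda(g)(x)=\lambda|x|^2-\mathrm{co}[\lambda|\cdot|^2-g](x)$, where $\mathrm{co}[h]$ denotes the convex envelope (the greatest convex function below $h$) of an extended-real-valued function $h$ on $\mathbb{R}^n$, and let $$A^{M,\infty}_\lambda(f_K)(x)=\tfrac12\left(C^l_\lambda(f_K^{M,\infty})(x)+C^u_\lambda(f_K^{-M,-\infty})(x)\right).$$ Let $r_c(x)=\inf\{r\ge 0:\ x\in\mathrm{co}[\bar B(x;r)\cap K]\}$ be the convex density radius of $x$ with respect to $K$, where $\mathrm{co}[E]$ is the convex hull of a set $E$. Then for all $\lambda>0$, all $M>A_0+\lambda\,\mathrm{diam}(U)^2$ and all $x\in\bar\Omega$, the value $A^{M,\infty}_\lambda(f_K)(x)$ is finite and $$\left|A^{M,\infty}_\lambda(f_K)(x)-f(x)\right|\le\omega\left(r_c(x)+\frac a\lambda+\sqrt{\frac b\lambda}\right).$$ -/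

import Mathlib

namespace Inpainting

open Set

noncomputable section

/-- The epigraph `{(x, μ) : g x ≤ μ}` of an extended-real-valued function. -/
def epigraph {E : Type*} (g : E → EReal) : Set (E × ℝ) :=
  {p | g p.1 ≤ (p.2 : EReal)}

/-- The convex envelope `co[g]` of an extended-real-valued function: the function obtained from the
convex hull of the epigraph of `g`. It is the greatest convex function below `g`, see
`isGreatest_convexEnvelope`. -/
def convexEnvelope {E : Type*} [AddCommGroup E] [Module ℝ E] (g : E → EReal) (x : E) : EReal :=
  sInf {v : EReal | ∃ μ : ℝ, v = (μ : EReal) ∧ (x, μ) ∈ convexHull ℝ (epigraph g)}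

/-- `convexEnvelope g` is the greatest function with convex epigraph that is majorized by `g`. -/
theorem isGreatest_convexEnvelope {E : Type*} [AddCommGroup E] [Module ℝ E] (g : E → EReal) :
    IsGreatest {h : E → EReal | Convex ℝ (epigraph h) ∧ h ≤ g} (convexEnvelope g) := by
  refine ⟨⟨?_, ?_⟩, ?_⟩
  · -- the envelope is convex
    have key : ∀ (x : E) (μ : ℝ), convexEnvelope g x ≤ (μ : EReal) ↔
        ∀ ε : ℝ, 0 < ε → (x, μ + ε) ∈ convexHull ℝ (epigraph g) := by
      have up : ∀ (x : E) (μ δ : ℝ), 0 ≤ δ → (x, μ) ∈ convexHull ℝ (epigraph g) →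
          (x, μ + δ) ∈ convexHull ℝ (epigraph g) := by
        intro x μ δ hδ hx
        let c : E × ℝ := (0, δ)
        have hc : Convex ℝ {p : E × ℝ | p + c ∈ convexHull ℝ (epigraph g)} :=
          (convex_convexHull ℝ (epigraph g)).translate_preimage_left c
        have hs : epigraph g ⊆ {p : E × ℝ | p + c ∈ convexHull ℝ (epigraph g)} := by
          intro p hp
          apply subset_convexHull
          simp only [epigraph, mem_ofPred_eq, c, Prod.fst_add, Prod.snd_add, add_zero] at hp ⊢
          exact hp.trans (by exact_mod_cast (by linarith : p.2 ≤ p.2 + δ))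
        have := convexHull_min hs hc hx
        simpa [c] using this
      intro x μ
      constructor
      · intro h ε hε
        have hlt : convexEnvelope g x < ((μ + ε : ℝ) : EReal) :=
          lt_of_le_of_lt h (by exact_mod_cast (by linarith : μ < μ + ε))
        obtain ⟨v, ⟨ν, rfl, hν⟩, hv⟩ := sInf_lt_iff.1 hlt
        have hv' : ν < μ + ε := by exact_mod_cast hv
        have := up x ν (μ + ε - ν) (by linarith) hν
        simpa using this
      · intro h
        apply EReal.le_of_forall_lt_iff_le.1
        intro z hz
        have hz' : μ < z := by exact_mod_cast hz
        apply sInf_le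
        refine ⟨z, rfl, ?_⟩
        have := h (z - μ) (by linarith)
        simpa using this
    rintro ⟨x, μ⟩ hx ⟨y, ν⟩ hy s t hs ht hst
    change convexEnvelope g (s • x + t • y) ≤ ((s * μ + t * ν : ℝ) : EReal)
    rw [key]
    intro ε hε
    have h1 := (key x μ).1 hx ε hε
    have h2 := (key y ν).1 hy ε hε
    have := convex_convexHull ℝ (epigraph g) h1 h2 hs ht hst
    have e : s • (x, μ + ε) + t • (y, ν + ε) = (s • x + t • y, s * μ + t * ν + ε) := by
      ext
      · simp
      · simp only [Prod.smul_mk, Prod.mk_add_mk, smul_eq_mul]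
        linear_combination ε * hst
    rwa [e] at this
  · intro x
    apply EReal.le_of_forall_lt_iff_le.1
    intro z hz
    exact sInf_le ⟨z, rfl, subset_convexHull ℝ _ (show g x ≤ (z : EReal) from hz.le)⟩
  · rintro h ⟨hconv, hle⟩ x
    apply le_sInf
    rintro v ⟨μ, rfl, hμ⟩
    have hs : epigraph g ⊆ epigraph h := fun p hp => (hle p.1).trans hp
    exact convexHull_min hs hconv hμ

/-- The quadratic lower compensated convex transform
`C^l_λ(f)(x) = co[λ|·|² + f](x) - λ|x|²`. -/
def lowerTransform {E : Type*} [NormedAddCommGroup E] [Module ℝ E]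
    (lam : ℝ) (f : E → EReal) (x : E) : EReal :=
  convexEnvelope (fun y => ((lam * ‖y‖ ^ 2 : ℝ) : EReal) + f y) x - ((lam * ‖x‖ ^ 2 : ℝ) : EReal)

/-- The quadratic upper compensated convex transform
`C^u_λ(f)(x) = λ|x|² - co[λ|·|² - f](x)`. -/
def upperTransform {E : Type*} [NormedAddCommGroup E] [Module ℝ E]
    (lam : ℝ) (f : E → EReal) (x : E) : EReal :=
  ((lam * ‖x‖ ^ 2 : ℝ) : EReal) - convexEnvelope (fun y => ((lam * ‖y‖ ^ 2 : ℝ) : EReal) - f y) x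

open Classical in
/-- The extension `f_K^{M,∞}`, where `K = closure Ω \ U`: the value is `f` on `K`, `M` on `U` and
`+∞` outside `closure Ω` (for `U ⊆ Ω`). -/
def plusExtension {E : Type*} [TopologicalSpace E] (Ω U : Set E) (f : E → ℝ) (M : ℝ) (x : E) :
    EReal :=
  if x ∈ closure Ω \ U then (f x : EReal) else if x ∈ U then (M : EReal) else ⊤

open Classical in
/-- The extension `f_K^{-M,-∞}`, where `K = closure Ω \ U`: the value is `f` on `K`, `-M` on `U` and
`-∞` outside `closure Ω` (for `U ⊆ Ω`). -/
def minusExtension {E : Type*} [TopologicalSpace E] (Ω U : Set E) (f : E → ℝ) (M : ℝ) (x : E) :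
    EReal :=
  if x ∈ closure Ω \ U then (f x : EReal) else if x ∈ U then ((-M : ℝ) : EReal) else ⊥

/-- The average approximation `A^{M,∞}_λ(f_K)`, where `K = closure Ω \ U`. -/
def averageApprox {E : Type*} [NormedAddCommGroup E] [Module ℝ E]
    (lam M : ℝ) (Ω U : Set E) (f : E → ℝ) (x : E) : EReal :=
  ((1 / 2 : ℝ) : EReal) *
    (lowerTransform lam (plusExtension Ω U f M) x + upperTransform lam (minusExtension Ω U f M) x)

/-- The modulus of continuity `ω_f(t) = sup {|f x - f y| : |x - y| ≤ t}` (for bounded `f`). -/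
def modulusOfContinuity {E : Type*} [PseudoMetricSpace E] (f : E → ℝ) (t : ℝ) : ℝ :=
  sSup {d : ℝ | ∃ x y : E, dist x y ≤ t ∧ d = |f x - f y|}

/-- The least concave majorant on `[0, ∞)` of a bounded function `h`: the pointwise infimum of all
concave majorants. -/
def leastConcaveMajorant (h : ℝ → ℝ) (t : ℝ) : ℝ :=
  sInf {v : ℝ | ∃ g : ℝ → ℝ, ConcaveOn ℝ (Ici 0) g ∧ (∀ s, 0 ≤ s → h s ≤ g s) ∧ v = g t}

/-- The convex density radius `r_c(x)` of `x` with respect to `K`. -/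
def convexDensityRadius {E : Type*} [PseudoMetricSpace E] [AddCommGroup E] [Module ℝ E]
    (K : Set E) (x : E) : ℝ :=
  sInf {r : ℝ | 0 ≤ r ∧ x ∈ convexHull ℝ (Metric.closedBall x r ∩ K)}

end

end Inpainting

namespace Inpainting

open Set Metric

/-! Write `x` as a finite convex combination of points of `K`; let `s` be its variance (mean of `‖y‖
^ 2` minus `‖x‖ ^ 2`) and `m` its mean of `f`. For large `M` the points of `U` do not affect the
envelopes (`convexEnvelope_plusExtension`), so the lower transform at `x` is the minimum of `m + lam
* s` and the upper one the maximum of `m - lam * s`, both attained by compactness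
(`isCompact_moments`).

Jensen for `ω ∘ √` gives `|m - f x| ≤ ω √s` (`abs_sub_le_of_mem_moments`). The least variance `q`
satisfies `√q ≤ r_c(x)`. Test one transform with the combination of variance `q` and use the optimal
combination for the other: on averaging, the terms `± lam * q` combine with `lam * s` into the
penalty `lam * (s - q)`, and `sub_mul_le_of_affine_bound` bounds `ω √s - lam * (s - q)`. -/

/-! ### Convex hulls of compact sets and rays leaving a bounded open set. -/

/-- In a finite-dimensional space the convex hull of a compact set is compact. -/
theorem isCompact_convexHull {E : Type*} [NormedAddCommGroup E] [NormedSpace ℝ E]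
    [FiniteDimensional ℝ E] {s : Set E} (hs : IsCompact s) : IsCompact (convexHull ℝ s) := by
  let Φ : (k : ℕ) → (Fin k → ℝ) × (Fin k → E) → E := fun k p => ∑ i, p.1 i • p.2 i
  -- Carathéodory: `finrank + 1` points suffice, hence the range up to `finrank + 2`.
  have heq : convexHull ℝ s = ⋃ k ∈ Finset.range (Module.finrank ℝ E + 2),
      Φ k '' (stdSimplex ℝ (Fin k) ×ˢ univ.pi fun _ => s) := by
    apply Subset.antisymm
    · intro x hx
      obtain ⟨ι, _, z, w, hz, hind, hw, hw1, hsum⟩ := eq_pos_convex_span_of_mem_convexHull hx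
      have hcard : Fintype.card ι ≤ Module.finrank ℝ E + 1 :=
        hind.card_le_finrank_succ.trans (by gcongr; exact Submodule.finrank_le _)
      let e := Fintype.equivFin ι
      simp only [mem_iUnion, exists_prop]
      refine ⟨Fintype.card ι, by simp; omega, (w ∘ e.symm, z ∘ e.symm), ⟨⟨?_, ?_⟩, ?_⟩, ?_⟩
      · exact fun i => (hw _).le
      · simpa [hw1] using e.symm.sum_comp w
      · exact fun i _ => hz ⟨_, rfl⟩
      · simpa [Φ, hsum] using e.symm.sum_comp fun i => w i • z i
    · simp only [iUnion_subset_iff]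
      rintro k - _ ⟨⟨w, z⟩, ⟨hw, hz⟩, rfl⟩
      exact (convex_convexHull ℝ s).sum_mem (fun i _ => hw.1 i) hw.2
        fun i _ => subset_convexHull ℝ s (hz i trivial)
  rw [heq]
  refine (Finset.range _).isCompact_biUnion fun k _ => ?_
  refine ((isCompact_stdSimplex ℝ (Fin k)).prod (isCompact_univ_pi fun _ => hs)).image ?_
  fun_prop

/-- A ray that starts in a bounded open set meets the frontier of this set. -/
theorem exists_add_smul_mem_frontier {E : Type*} [NormedAddCommGroup E] [NormedSpace ℝ E]
    {U : Set E} (hU : IsOpen U) (hb : Bornology.IsBounded U) {y v : E} (hy : y ∈ U) (hv : v ≠ 0) :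
    ∃ t : ℝ, 0 < t ∧ y + t • v ∈ frontier U := by
  let φ : ℝ → E := fun t => y + t • v
  have hφ : Continuous φ := by fun_prop
  have hpre : IsPreconnected (φ '' Ici 0) := isPreconnected_Ici.image _ hφ.continuousOn
  have hout : (φ '' Ici 0 ∩ Uᶜ).Nonempty := by
    obtain ⟨R, hR⟩ := hb.subset_closedBall y
    have hv' : 0 < ‖v‖ := norm_pos_iff.2 hv
    refine ⟨φ ((|R| + 1) / ‖v‖), ⟨_, mem_Ici.2 (by positivity), rfl⟩, fun h => ?_⟩
    have := hR h
    rw [mem_closedBall, dist_eq_norm] at this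
    simp only [φ, add_sub_cancel_left, norm_smul, norm_div, norm_norm] at this
    rw [div_mul_cancel₀ _ hv'.ne', Real.norm_of_nonneg (by positivity)] at this
    linarith [le_abs_self R]
  obtain ⟨t, ht, hf⟩ : ∃ t, 0 ≤ t ∧ φ t ∈ frontier U := by
    by_contra! hcon
    rw [hU.frontier_eq] at hcon
    obtain ⟨p, hp, hpU⟩ := hout
    -- A ray missing the frontier would be disconnected by `U` and the exterior of `U`.
    obtain ⟨q, -, hqU, hq⟩ := hpre U (closure U)ᶜ hU isClosed_closure.isOpen_compl
      (by
        rintro _ ⟨t, ht, rfl⟩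
        by_cases h : φ t ∈ U
        · exact Or.inl h
        · exact Or.inr fun hc => hcon t ht ⟨hc, h⟩)
      ⟨y, ⟨0, mem_Ici.2 le_rfl, by simp [φ]⟩, hy⟩
      ⟨p, hp, by
        obtain ⟨t, ht, rfl⟩ := hp
        exact fun hc => hcon t ht ⟨hc, hpU⟩⟩
    exact hq (subset_closure hqU)
  refine ⟨t, lt_of_le_of_ne ht ?_, hf⟩
  rintro rfl
  simp only [φ, zero_smul, add_zero] at hf
  exact (hU.frontier_eq ▸ hf).2 hy

theorem frontier_subset_closure_diff {E : Type*} [TopologicalSpace E] {Ω U : Set E} (hU : IsOpen U) (hUΩ : closure U ⊆ Ω) :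
    frontier U ⊆ closure Ω \ U := by
  rw [hU.frontier_eq]
  exact fun z hz => ⟨subset_closure (hUΩ hz.1), hz.2⟩

variable {E : Type*} [NormedAddCommGroup E] [InnerProductSpace ℝ E]

/-! ### Eliminating the points of `U` from the envelope. -/

/-- Over a point of `U`, the graph of `lam * ‖·‖ ^ 2 + g` over `frontier U` has convex combinations
of height at most `lam * (‖y‖ ^ 2 + diam U ^ 2)` plus a bound for `g`. -/
theorem exists_mem_convexHull_graph_frontier [Nontrivial E] {U : Set E} (hU : IsOpen U)
    (hb : Bornology.IsBounded U) {g : E → ℝ} {A lam : ℝ} (hlam : 0 ≤ lam)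
    (hg : ∀ z ∈ frontier U, g z ≤ A) {y : E} (hy : y ∈ U) :
    ∃ μ ≤ lam * (‖y‖ ^ 2 + diam U ^ 2) + A,
      (y, μ) ∈ convexHull ℝ ((fun z => (z, lam * ‖z‖ ^ 2 + g z)) '' frontier U) := by
  obtain ⟨v, hv⟩ := exists_ne (0 : E)
  obtain ⟨t, ht, htf⟩ := exists_add_smul_mem_frontier hU hb hy hv
  obtain ⟨s, hs, hsf⟩ := exists_add_smul_mem_frontier hU hb hy (neg_ne_zero.2 hv)
  have hdist : ∀ u : E, y + u ∈ frontier U → ‖u‖ ^ 2 ≤ diam U ^ 2 := by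
    intro u hu
    have := dist_le_diam_of_mem hb.closure (frontier_subset_closure hu) (subset_closure hy)
    rw [diam_closure, dist_eq_norm, add_sub_cancel_left] at this
    gcongr
  have hst : 0 < s + t := by positivity
  have hsum : s / (s + t) + t / (s + t) = 1 := by field_simp
  have hmem := convex_convexHull ℝ ((fun z => (z, lam * ‖z‖ ^ 2 + g z)) '' frontier U)
    (subset_convexHull ℝ _ (mem_image_of_mem _ htf))
    (subset_convexHull ℝ _ (mem_image_of_mem _ hsf))
    (div_nonneg hs.le hst.le) (div_nonneg ht.le hst.le) hsum
  -- The weights make `y` the barycentre of the two frontier points found in directions `v` and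
  -- `-v`.
  have hpt : (s / (s + t)) • (y + t • v) + (t / (s + t)) • (y + s • -v) = y := by
    have : (s / (s + t)) * t = (t / (s + t)) * s := by ring
    rw [smul_add, smul_add, smul_smul, smul_smul, smul_neg, this, add_add_add_comm,
      ← add_smul, hsum]
    simp
  simp only [Prod.smul_mk, Prod.mk_add_mk, hpt, smul_eq_mul] at hmem
  refine ⟨_, ?_, hmem⟩
  have e1 := norm_add_sq_real y (t • v)
  have e2 := norm_add_sq_real y (s • -v)
  rw [inner_smul_right] at e1 e2
  rw [inner_neg_right] at e2
  have h1 := hdist _ htf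
  have h2 := hdist _ hsf
  have g1 := hg _ htf
  have g2 := hg _ hsf
  set α := s / (s + t) with hα
  set β := t / (s + t) with hβ
  have hα0 : 0 ≤ α := by positivity
  have hβ0 : 0 ≤ β := by positivity
  have hbal : α * t = β * s := by rw [hα, hβ]; ring
  rw [e1, e2]
  have k1 : α * (lam * ‖t • v‖ ^ 2 + g (y + t • v)) ≤ α * (lam * diam U ^ 2 + A) := by gcongr
  have k2 : β * (lam * ‖s • -v‖ ^ 2 + g (y + s • -v)) ≤ β * (lam * diam U ^ 2 + A) := by gcongr
  have hβ1 : β = 1 - α := by linarith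
  -- The cross terms with `inner ℝ y v` cancel since `α * t = β * s`.
  have : (α + β) * (lam * ‖y‖ ^ 2 + (lam * diam U ^ 2 + A))
      + 2 * lam * inner ℝ y v * (α * t - β * s) = lam * (‖y‖ ^ 2 + diam U ^ 2) + A := by
    rw [hbal, hsum]; ring
  linarith

/-- A point of `U` lies on a segment between frontier points: forget the heights in the previous
lemma. -/
theorem closure_subset_convexHull_diff [Nontrivial E] {Ω U : Set E} (hU : IsOpen U)
    (hb : Bornology.IsBounded U) (hUΩ : closure U ⊆ Ω) :
    closure Ω ⊆ convexHull ℝ (closure Ω \ U) := by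
  intro x hx
  by_cases hxU : x ∈ U
  · obtain ⟨μ, -, h⟩ := exists_mem_convexHull_graph_frontier hU hb le_rfl
      (g := fun _ => 0) (A := 0) (fun _ _ => le_rfl) hxU
    have := mem_image_of_mem (LinearMap.fst ℝ E ℝ) h
    rw [LinearMap.image_convexHull, image_image] at this
    refine convexHull_mono ?_ this
    rintro _ ⟨z, hz, rfl⟩
    exact frontier_subset_closure_diff hU hUΩ hz
  · exact subset_convexHull ℝ _ ⟨hx, hxU⟩

/-- The convex envelope that defines the lower transform of `plusExtension Ω U g M` is, for large
`M`, the lower boundary of the convex hull of the graph over `closure Ω \ U`. -/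
theorem convexEnvelope_plusExtension [Nontrivial E] {Ω U : Set E} (hU : IsOpen U)
    (hb : Bornology.IsBounded U) (hUΩ : closure U ⊆ Ω) {g : E → ℝ} {A lam M : ℝ} (hlam : 0 ≤ lam)
    (hg : ∀ z ∈ closure Ω \ U, g z ≤ A) (hM : A + lam * diam U ^ 2 ≤ M) {x : E} {v : ℝ}
    (hv : IsLeast {μ : ℝ | (x, μ) ∈
      convexHull ℝ ((fun z => (z, lam * ‖z‖ ^ 2 + g z)) '' (closure Ω \ U))} v) :
    convexEnvelope (fun y => ((lam * ‖y‖ ^ 2 : ℝ) : EReal) + plusExtension Ω U g M y) x = v := by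
  set H := convexHull ℝ ((fun z => (z, lam * ‖z‖ ^ 2 + g z)) '' (closure Ω \ U)) with hH
  apply le_antisymm
  · refine sInf_le ⟨v, rfl, convexHull_mono ?_ hv.1⟩
    rintro _ ⟨z, hz, rfl⟩
    simp [epigraph, plusExtension, hz]
  · refine le_sInf ?_
    rintro _ ⟨μ, rfl, hμ⟩
    -- The points on or above `H` form a convex set; the bound on `M` puts the part of the epigraph
    -- over `U` inside it.
    have hconv : Convex ℝ {p : E × ℝ | ∃ μ' ≤ p.2, (p.1, μ') ∈ H} := by
      rintro p ⟨μ, hμ, hp⟩ q ⟨ν, hν, hq⟩ s t hs ht hst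
      refine ⟨s * μ + t * ν, ?_, by simpa using convex_convexHull ℝ _ hp hq hs ht hst⟩
      simp only [Prod.snd_add, Prod.smul_snd, smul_eq_mul]
      gcongr
    have hsub : epigraph (fun y => ((lam * ‖y‖ ^ 2 : ℝ) : EReal) + plusExtension Ω U g M y) ⊆
        {p : E × ℝ | ∃ μ' ≤ p.2, (p.1, μ') ∈ H} := by
      rintro ⟨y, μ⟩ hy
      simp only [epigraph, plusExtension, mem_ofPred_eq] at hy
      split_ifs at hy with h1 h2
      · exact ⟨_, by exact_mod_cast hy, subset_convexHull ℝ _ ⟨y, h1, rfl⟩⟩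
      · obtain ⟨μ', hle, hmem⟩ := exists_mem_convexHull_graph_frontier hU hb hlam
          (fun z hz => hg z (frontier_subset_closure_diff hU hUΩ hz)) h2
        refine ⟨μ', ?_, convexHull_mono
          (image_mono (frontier_subset_closure_diff hU hUΩ)) hmem⟩
        have : lam * ‖y‖ ^ 2 + M ≤ μ := by exact_mod_cast hy
        change μ' ≤ μ
        linarith
      · rw [EReal.coe_add_top] at hy
        exact absurd hy (by simp)
    obtain ⟨μ', hle, hmem⟩ := convexHull_min hsub hconv hμ
    exact_mod_cast (hv.2 hmem).trans hle

/-! ### Concave moduli of continuity. -/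

/-- A concave function on `[0, ∞)` that is bounded below is monotone. -/
theorem monotoneOn_of_concaveOn_of_nonneg {g : ℝ → ℝ} (hg : ConcaveOn ℝ (Ici 0) g)
    (h0 : ∀ t, 0 ≤ t → 0 ≤ g t) : MonotoneOn g (Ici 0) := by
  intro s hs t ht hst
  by_contra! hlt
  have hst' : s < t := lt_of_le_of_ne hst (by rintro rfl; exact lt_irrefl _ hlt)
  rw [mem_Ici] at hs ht
  set d := g s - g t with hd
  have hd0 : 0 < d := by linarith
  -- The line through the graph points at `s` and `t` has height `-d < 0` at `T`, and concavity
  -- keeps `g T` below it.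
  set T := t + (t - s) * (g t + d) / d with hT
  have hgt := h0 t ht
  have hTt : t < T := by
    have : 0 < (t - s) * (g t + d) / d := div_pos (mul_pos (by linarith) (by linarith)) hd0
    linarith
  have hslope := hg.slope_anti_adjacent (mem_Ici.2 hs) (mem_Ici.2 (ht.trans hTt.le)) hst' hTt
  have hTg := h0 T (ht.trans hTt.le)
  rw [div_le_div_iff₀ (by linarith) (by linarith)] at hslope
  have e : T - t = (t - s) * (g t + d) / d := by rw [hT]; ring
  have e2 : (g t - g s) * (T - t) = -((t - s) * (g t + d)) := by
    rw [e, hd]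
    have : g s - g t ≠ 0 := hd0.ne'
    field_simp
    ring
  rw [e2] at hslope
  nlinarith [mul_pos (sub_pos.2 hst') hd0, mul_nonneg (sub_pos.2 hst').le hTg]

section Modulus

variable {X : Type*} [PseudoMetricSpace X] {f : X → ℝ} {C : ℝ}

theorem abs_sub_le_modulusOfContinuity (hC : ∀ x, |f x| ≤ C) {x y : X} {t : ℝ}
    (h : dist x y ≤ t) : |f x - f y| ≤ modulusOfContinuity f t := by
  refine le_csSup ⟨C + C, ?_⟩ ⟨x, y, h, rfl⟩
  rintro _ ⟨x, y, -, rfl⟩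
  exact (abs_sub _ _).trans (add_le_add (hC x) (hC y))

theorem modulusOfContinuity_nonneg (f : X → ℝ) (t : ℝ) : 0 ≤ modulusOfContinuity f t := by
  refine Real.sSup_nonneg ?_
  rintro _ ⟨x, y, -, rfl⟩
  exact abs_nonneg _

theorem modulusOfContinuity_le (hC0 : 0 ≤ C) (hC : ∀ x, |f x| ≤ C) (t : ℝ) :
    modulusOfContinuity f t ≤ C + C := by
  refine Real.sSup_le ?_ (by positivity)
  rintro _ ⟨x, y, -, rfl⟩
  exact (abs_sub _ _).trans (add_le_add (hC x) (hC y))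

end Modulus

section Majorant

variable {h : ℝ → ℝ} {B : ℝ}

theorem bddBelow_concaveMajorants (h : ℝ → ℝ) {t : ℝ} (ht : 0 ≤ t) :
    BddBelow {v : ℝ | ∃ g : ℝ → ℝ, ConcaveOn ℝ (Ici 0) g ∧ (∀ s, 0 ≤ s → h s ≤ g s) ∧ v = g t} := by
  refine ⟨h t, ?_⟩
  rintro _ ⟨g, -, hg, rfl⟩
  exact hg t ht

theorem nonempty_concaveMajorants (hB : ∀ t, h t ≤ B) (t : ℝ) :
    {v : ℝ | ∃ g : ℝ → ℝ, ConcaveOn ℝ (Ici 0) g ∧ (∀ s, 0 ≤ s → h s ≤ g s) ∧ v = g t}.Nonempty :=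
  ⟨B, fun _ => B, concaveOn_const B (convex_Ici 0), fun s _ => hB s, rfl⟩

theorem le_leastConcaveMajorant (hB : ∀ t, h t ≤ B) {t : ℝ} (ht : 0 ≤ t) :
    h t ≤ leastConcaveMajorant h t := by
  refine le_csInf (nonempty_concaveMajorants hB t) ?_
  rintro _ ⟨g, -, hg, rfl⟩
  exact hg t ht

theorem concaveOn_leastConcaveMajorant (hB : ∀ t, h t ≤ B) :
    ConcaveOn ℝ (Ici 0) (leastConcaveMajorant h) := by
  refine ⟨convex_Ici 0, fun s hs t ht α β hα hβ hαβ => ?_⟩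
  refine le_csInf (nonempty_concaveMajorants hB _) ?_
  rintro _ ⟨g, hgc, hg, rfl⟩
  refine le_trans ?_ (hgc.2 hs ht hα hβ hαβ)
  have h1 : leastConcaveMajorant h s ≤ g s :=
    csInf_le (bddBelow_concaveMajorants h hs) ⟨g, hgc, hg, rfl⟩
  have h2 : leastConcaveMajorant h t ≤ g t :=
    csInf_le (bddBelow_concaveMajorants h ht) ⟨g, hgc, hg, rfl⟩
  simp only [smul_eq_mul]
  gcongr

end Majorant

/-- The mean squared distance to `x`, unlike the mean distance, is an affine function of the
moments, so Jensen is needed in the squared variable. -/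
theorem concaveOn_comp_sqrt {g : ℝ → ℝ} (hg : ConcaveOn ℝ (Ici 0) g)
    (hm : MonotoneOn g (Ici 0)) : ConcaveOn ℝ (Ici 0) fun s => g √s := by
  refine ⟨convex_Ici 0, fun s hs t ht α β hα hβ hαβ => ?_⟩
  have h1 := hg.2 (mem_Ici.2 (Real.sqrt_nonneg s)) (mem_Ici.2 (Real.sqrt_nonneg t)) hα hβ hαβ
  have h2 := Real.strictConcaveOn_sqrt.concaveOn.2 hs ht hα hβ hαβ
  refine h1.trans (hm ?_ (Real.sqrt_nonneg _) h2)
  simp only [smul_eq_mul, mem_Ici]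
  positivity

/-! ### Moments of convex combinations. -/

/-- The pairs of averages of `‖·‖ ^ 2` and of `f` over the convex combinations of points of `K`
that represent `x`. -/
def moments (K : Set E) (f : E → ℝ) (x : E) : Set (ℝ × ℝ) :=
  {p | (x, p) ∈ convexHull ℝ ((fun y => (y, (‖y‖ ^ 2, f y))) '' K)}

/-- The moments are the projected fibre over `x` of the compact hull of a compact graph. -/
theorem isCompact_moments [FiniteDimensional ℝ E] {K : Set E} (hK : IsCompact K) {f : E → ℝ}
    (hf : ContinuousOn f K) (x : E) : IsCompact (moments K f x) := by
  have hc : IsCompact (convexHull ℝ ((fun y => (y, (‖y‖ ^ 2, f y))) '' K)) :=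
    isCompact_convexHull (hK.image_of_continuousOn (by fun_prop))
  have himage : moments K f x =
      Prod.snd '' (convexHull ℝ ((fun y => (y, (‖y‖ ^ 2, f y))) '' K) ∩ Prod.fst ⁻¹' {x}) := by
    ext p
    constructor
    · exact fun hp => ⟨(x, p), ⟨hp, rfl⟩, rfl⟩
    · rintro ⟨⟨_, p⟩, ⟨hp, rfl⟩, rfl⟩
      exact hp
  rw [himage]
  exact (hc.inter_right (isClosed_singleton.preimage continuous_fst)).image continuous_snd

theorem exists_mem_moments {K : Set E} (f : E → ℝ) {x : E} {r : ℝ}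
    (hx : x ∈ convexHull ℝ (closedBall x r ∩ K)) :
    ∃ p ∈ moments K f x, p.1 - ‖x‖ ^ 2 ≤ r ^ 2 := by
  have hfst : x ∈ LinearMap.fst ℝ E (ℝ × ℝ) ''
      convexHull ℝ ((fun y => (y, (‖y‖ ^ 2, f y))) '' (closedBall x r ∩ K)) := by
    rw [LinearMap.image_convexHull, image_image]
    simpa using hx
  obtain ⟨⟨_, p⟩, hp, rfl⟩ := hfst
  refine ⟨p, convexHull_mono (image_mono inter_subset_right) hp, ?_⟩
  rw [LinearMap.fst_apply] at *
  rename_i y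
  -- On the graph, `l` is the squared distance to `y` minus `‖y‖ ^ 2`; being linear, it keeps its
  -- bound on the hull.
  let l : E × (ℝ × ℝ) → ℝ := fun q => q.2.1 - 2 * inner ℝ y q.1
  have hl : IsLinearMap ℝ l := by
    constructor
    · intro a b
      simp only [l, Prod.snd_add, Prod.fst_add, inner_add_right]; ring
    · intro c a
      simp only [l, Prod.smul_snd, Prod.smul_fst, inner_smul_right, smul_eq_mul]; ring
  have hsub : (fun z => (z, (‖z‖ ^ 2, f z))) '' (closedBall y r ∩ K) ⊆
      {q | l q ≤ r ^ 2 - ‖y‖ ^ 2} := by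
    rintro _ ⟨z, ⟨hz, -⟩, rfl⟩
    rw [mem_closedBall', dist_eq_norm] at hz
    have h1 := norm_sub_sq_real y z
    have h2 : ‖y - z‖ ^ 2 ≤ r ^ 2 := by gcongr
    simp only [l, mem_ofPred_eq]
    linarith
  have := convexHull_min hsub (convex_halfSpace_le hl _) hp
  simp only [l, mem_ofPred_eq, real_inner_self_eq_norm_sq] at this
  linarith

/-- Jensen's inequality for a concave modulus of continuity. -/
theorem abs_sub_le_of_mem_moments {K : Set E} {f : E → ℝ} {x : E} {g : ℝ → ℝ}
    (hg : ConcaveOn ℝ (Ici 0) g) (hm : MonotoneOn g (Ici 0))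
    (hfg : ∀ y ∈ K, |f y - f x| ≤ g (dist y x)) {p : ℝ × ℝ} (hp : p ∈ moments K f x) :
    0 ≤ p.1 - ‖x‖ ^ 2 ∧ |p.2 - f x| ≤ g √(p.1 - ‖x‖ ^ 2) := by
  let l : E × (ℝ × ℝ) → ℝ := fun q => q.2.1 - 2 * inner ℝ x q.1 + ‖x‖ ^ 2
  have hl : ∀ (q q' : E × (ℝ × ℝ)) (α β : ℝ), α + β = 1 →
      l (α • q + β • q') = α * l q + β * l q' := by
    intro q q' α β h
    simp only [l, Prod.snd_add, Prod.fst_add, Prod.smul_snd, Prod.smul_fst, inner_add_right,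
      inner_smul_right, smul_eq_mul]
    linear_combination (-‖x‖ ^ 2) * h
  have hs := concaveOn_comp_sqrt hg hm
  have hconv : Convex ℝ {q : E × (ℝ × ℝ) | 0 ≤ l q ∧ |q.2.2 - f x| ≤ g √(l q)} := by
    rintro q ⟨h1, h2⟩ q' ⟨h1', h2'⟩ α β hα hβ hαβ
    refine ⟨by rw [hl _ _ _ _ hαβ]; positivity, ?_⟩
    have h3 := hs.2 (mem_Ici.2 h1) (mem_Ici.2 h1') hα hβ hαβ
    simp only [smul_eq_mul] at h3
    rw [hl _ _ _ _ hαβ]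
    refine le_trans ?_ h3
    have e : (α • q + β • q').2.2 - f x = α * (q.2.2 - f x) + β * (q'.2.2 - f x) := by
      simp only [Prod.snd_add, Prod.smul_snd, smul_eq_mul]
      linear_combination f x * hαβ
    rw [e]
    refine (abs_add_le _ _).trans ?_
    rw [abs_mul, abs_mul, abs_of_nonneg hα, abs_of_nonneg hβ]
    gcongr
  have hsub : (fun y => (y, (‖y‖ ^ 2, f y))) '' K ⊆
      {q : E × (ℝ × ℝ) | 0 ≤ l q ∧ |q.2.2 - f x| ≤ g √(l q)} := by
    rintro _ ⟨y, hy, rfl⟩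
    have e : l (y, (‖y‖ ^ 2, f y)) = dist y x ^ 2 := by
      rw [dist_comm, dist_eq_norm, norm_sub_sq_real]; simp only [l]; ring
    simp only [mem_ofPred_eq, e, Real.sqrt_sq dist_nonneg]
    exact ⟨by positivity, hfg y hy⟩
  have h := convexHull_min hsub hconv hp
  have e : l (x, p) = p.1 - ‖x‖ ^ 2 := by
    simp only [l, real_inner_self_eq_norm_sq]; ring
  rwa [mem_ofPred_eq, e] at h

/-- Linear images of the moments are fibres of convex hulls of graphs. -/
theorem image_moments (K : Set E) (f : E → ℝ) (x : E) (c d : ℝ) :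
    (fun p : ℝ × ℝ => c * p.1 + d * p.2) '' moments K f x =
      {μ : ℝ | (x, μ) ∈ convexHull ℝ ((fun y => (y, c * ‖y‖ ^ 2 + d * f y)) '' K)} := by
  let T : E × (ℝ × ℝ) →ₗ[ℝ] E × ℝ := LinearMap.prodMap LinearMap.id
    (c • LinearMap.fst ℝ ℝ ℝ + d • LinearMap.snd ℝ ℝ ℝ)
  have hT : convexHull ℝ ((fun y => (y, c * ‖y‖ ^ 2 + d * f y)) '' K) =
      T '' convexHull ℝ ((fun y => (y, (‖y‖ ^ 2, f y))) '' K) := by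
    rw [LinearMap.image_convexHull, image_image]
    simp [T]
  ext μ
  rw [mem_ofPred_eq, hT]
  constructor
  · rintro ⟨p, hp, rfl⟩
    exact ⟨(x, p), hp, by simp [T]⟩
  · rintro ⟨⟨y, p⟩, hp, h⟩
    simp only [T, LinearMap.prodMap_apply, LinearMap.id_apply, LinearMap.add_apply,
      LinearMap.smul_apply, LinearMap.fst_apply, LinearMap.snd_apply, smul_eq_mul,
      Prod.mk.injEq] at h
    obtain ⟨rfl, rfl⟩ := h
    exact ⟨p, hp, rfl⟩

/-! ### The penalized estimate and the conclusion. -/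

/-- A penalized increment of a modulus with affine bound `a * t + b` is controlled by its value at
a bounded distance. -/
theorem sub_mul_le_of_affine_bound {g : ℝ → ℝ} (hm : MonotoneOn g (Ici 0))
    (h0 : ∀ t, 0 ≤ t → 0 ≤ g t) {a b lam : ℝ} (ha : 0 ≤ a) (hb : 0 ≤ b) (hlam : 0 < lam)
    (hab : ∀ t, 0 ≤ t → g t ≤ a * t + b) {q s r : ℝ} (hq : 0 ≤ q) (hqs : q ≤ s) (hqr : √q ≤ r) :
    g √s - lam * (s - q) ≤ g (r + a / lam + √(b / lam)) := by
  have hr : 0 ≤ r := (Real.sqrt_nonneg q).trans hqr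
  have hρ : 0 ≤ a / lam := by positivity
  have hσ := Real.sqrt_nonneg (b / lam)
  have hR := Real.sqrt_nonneg s
  have hP := Real.sqrt_nonneg q
  by_cases hle : √s ≤ r + a / lam + √(b / lam)
  · have := hm (mem_Ici.2 hR) (mem_Ici.2 (by positivity)) hle
    have : 0 ≤ lam * (s - q) := mul_nonneg hlam.le (by linarith)
    linarith
  -- Here the penalty is at least `a * √s + b ≥ g √s`, so the left side is nonpositive.
  · push Not at hle
    have hgs := hab _ hR
    have hpos := h0 (r + a / lam + √(b / lam)) (by positivity)
    have es : √s ^ 2 = s := Real.sq_sqrt (hq.trans hqs)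
    have eq : √q ^ 2 = q := Real.sq_sqrt hq
    have eb : lam * √(b / lam) ^ 2 = b := by
      rw [Real.sq_sqrt (by positivity)]; field_simp
    have ea : lam * (a / lam) = a := by field_simp
    set R := √s
    set P := √q
    set σ := √(b / lam)
    set ρ := a / lam
    have h1 : ρ + σ ≤ R - P := by linarith
    have h2 : (ρ + σ) * (R + P) ≤ (R - P) * (R + P) := by gcongr
    have h3 : ρ * R + σ * σ ≤ (ρ + σ) * (R + P) := by
      have : σ * σ ≤ σ * R := by gcongr; linarith
      nlinarith [mul_nonneg (add_nonneg hρ hσ) hP]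
    have h4 : lam * (ρ * R + σ * σ) ≤ lam * ((R - P) * (R + P)) := by gcongr; exact h3.trans h2
    have h5 : lam * (ρ * R + σ * σ) = a * R + b := by
      rw [← ea, ← eb]; ring
    have h6 : (R - P) * (R + P) = s - q := by rw [← es, ← eq]; ring
    rw [h5, h6] at h4
    linarith

theorem upperTransform_minusExtension (lam M : ℝ) (Ω U : Set E) (f : E → ℝ) (x : E) :
    upperTransform lam (minusExtension Ω U f M) x = ((lam * ‖x‖ ^ 2 : ℝ) : EReal) -
      convexEnvelope (fun y => ((lam * ‖y‖ ^ 2 : ℝ) : EReal) +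
        plusExtension Ω U (fun z => -f z) M y) x := by
  unfold upperTransform
  congr 2
  funext y
  rw [sub_eq_add_neg]
  congr 1
  simp only [minusExtension, plusExtension]
  split_ifs <;> simp

end Inpainting

theorem corollary5p3 (n : ℕ) (hn : 1 ≤ n)
    (Ω U : Set (EuclideanSpace ℝ (Fin n)))
    (hΩne : Ω.Nonempty) (hΩbdd : Bornology.IsBounded Ω) (hΩopen : IsOpen Ω) (hΩconv : Convex ℝ Ω)
    (hUopen : IsOpen U) (hUΩ : closure U ⊆ Ω)
    (f : EuclideanSpace ℝ (Fin n) → ℝ) (hf : ContinuousOn f (closure Ω))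
    (fext : EuclideanSpace ℝ (Fin n) → ℝ) (hext : Set.EqOn fext f (closure Ω))
    (hbdd : ∃ C : ℝ, ∀ x, |fext x| ≤ C) (huc : UniformContinuous fext)
    (ω : ℝ → ℝ) (hω : ω = Inpainting.leastConcaveMajorant (Inpainting.modulusOfContinuity fext))
    (a b : ℝ) (ha : 0 ≤ a) (hb : 0 ≤ b) (hab : ∀ t, 0 ≤ t → ω t ≤ a * t + b)
    (A₀ : ℝ) (hA₀ : ∀ x ∈ closure Ω \ U, |f x| ≤ A₀)
    (lam : ℝ) (hlam : 0 < lam)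
    (M : ℝ) (hM : A₀ + lam * Metric.diam U ^ 2 < M)
    (x : EuclideanSpace ℝ (Fin n)) (hx : x ∈ closure Ω) :
    ∃ v : ℝ, Inpainting.averageApprox lam M Ω U f x = (v : EReal) ∧
      |v - f x| ≤
        ω (Inpainting.convexDensityRadius (closure Ω \ U) x + a / lam + √(b / lam)) := by
  open Inpainting Set Metric in
  have : Nonempty (Fin n) := ⟨⟨0, hn⟩⟩
  have hUbdd : Bornology.IsBounded U := hΩbdd.subset (subset_closure.trans hUΩ)
  set K := closure Ω \ U with hKdef
  have hK : IsCompact K :=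
    hΩbdd.isCompact_closure.of_isClosed_subset (isClosed_closure.sdiff hUopen) sdiff_subset
  obtain ⟨C, hC⟩ := hbdd
  have hC0 : 0 ≤ C := (abs_nonneg _).trans (hC x)
  have hB := modulusOfContinuity_le hC0 hC
  have hmaj : ∀ t, 0 ≤ t → modulusOfContinuity fext t ≤ ω t := fun t ht =>
    hω ▸ le_leastConcaveMajorant hB ht
  have hconc : ConcaveOn ℝ (Ici 0) ω := hω ▸ concaveOn_leastConcaveMajorant hB
  have hnonneg : ∀ t, 0 ≤ t → 0 ≤ ω t := fun t ht =>
    (modulusOfContinuity_nonneg fext t).trans (hmaj t ht)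
  have hmono := monotoneOn_of_concaveOn_of_nonneg hconc hnonneg
  have hfω : ∀ y ∈ K, |f y - f x| ≤ ω (dist y x) := fun y hy => by
    rw [← hext hx, ← hext hy.1]
    exact (abs_sub_le_modulusOfContinuity hC le_rfl).trans (hmaj _ dist_nonneg)
  have hJensen := fun p (hp : p ∈ moments K f x) => abs_sub_le_of_mem_moments hconc hmono hfω hp
  -- the moments are compact and non-empty
  have hQ := isCompact_moments hK (hf.mono sdiff_subset) x
  have hxK : x ∈ convexHull ℝ K := closure_subset_convexHull_diff hUopen hUbdd hUΩ hx
  obtain ⟨R, hR0, hKR⟩ : ∃ R : ℝ, 0 ≤ R ∧ K ⊆ closedBall x R := by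
    obtain ⟨R, hR⟩ := hK.isBounded.subset_closedBall x
    exact ⟨max R 0, le_max_right _ _, hR.trans (closedBall_subset_closedBall (le_max_left _ _))⟩
  have hxR : x ∈ convexHull ℝ (closedBall x R ∩ K) := by rwa [inter_eq_right.2 hKR]
  have hQne : (moments K f x).Nonempty :=
    let ⟨p, hp, _⟩ := exists_mem_moments f hxR
    ⟨p, hp⟩
  -- `p₀` has least variance; `p₁` and `p₂` realize the lower and upper transforms.
  obtain ⟨p₀, hp₀, hmin₀⟩ := hQ.exists_isMinOn hQne (continuous_fst.continuousOn)
  obtain ⟨p₁, hp₁, hmin₁⟩ := hQ.exists_isMinOn hQne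
    (f := fun p => lam * p.1 + 1 * p.2) (by fun_prop)
  obtain ⟨p₂, hp₂, hmin₂⟩ := hQ.exists_isMinOn hQne
    (f := fun p => lam * p.1 + (-1) * p.2) (by fun_prop)
  rw [isMinOn_iff] at hmin₀ hmin₁ hmin₂
  have hleast : ∀ d p, p ∈ moments K f x →
      (∀ q ∈ moments K f x, lam * p.1 + d * p.2 ≤ lam * q.1 + d * q.2) →
      IsLeast {μ : ℝ | (x, μ) ∈ convexHull ℝ ((fun y => (y, lam * ‖y‖ ^ 2 + d * f y)) '' K)}
        (lam * p.1 + d * p.2) := by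
    intro d p hp hmin
    rw [← image_moments]
    refine ⟨⟨p, hp, rfl⟩, ?_⟩
    rintro _ ⟨q, hq, rfl⟩
    exact hmin q hq
  have hco₁ := convexEnvelope_plusExtension hUopen hUbdd hUΩ hlam.le (g := f)
    (fun z hz => (abs_le.1 (hA₀ z hz)).2) hM.le (by simpa using hleast 1 p₁ hp₁ hmin₁)
  have hco₂ := convexEnvelope_plusExtension hUopen hUbdd hUΩ hlam.le (g := fun z => -f z)
    (fun z hz => neg_le.1 (abs_le.1 (hA₀ z hz)).1) hM.le
    (by simpa using hleast (-1) p₂ hp₂ hmin₂)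
  refine ⟨1 / 2 * ((lam * p₁.1 + p₁.2 - lam * ‖x‖ ^ 2) +
    (lam * ‖x‖ ^ 2 - (lam * p₂.1 + -p₂.2))), ?_, ?_⟩
  · rw [averageApprox, upperTransform_minusExtension, lowerTransform, hco₁, hco₂]
    norm_cast
  have hr : √(p₀.1 - ‖x‖ ^ 2) ≤ convexDensityRadius K x := by
    refine le_csInf ⟨R, hR0, hxR⟩ ?_
    rintro r ⟨hr0, hr⟩
    obtain ⟨p, hp, hpr⟩ := exists_mem_moments f hr
    rw [Real.sqrt_le_left hr0]
    linarith [hmin₀ p hp]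
  have hpen : ∀ p ∈ moments K f x, ω √(p.1 - ‖x‖ ^ 2) - lam * (p.1 - p₀.1) ≤
      ω (convexDensityRadius K x + a / lam + √(b / lam)) := fun p hp => by
    have := sub_mul_le_of_affine_bound hmono hnonneg ha hb hlam hab (hJensen p₀ hp₀).1
      (sub_le_sub_right (hmin₀ p hp) _) hr
    rwa [sub_sub_sub_cancel_right] at this
  have h0 := hpen p₀ hp₀
  have h1 := hpen p₁ hp₁
  have h2 := hpen p₂ hp₂
  have j0 := abs_le.1 (hJensen p₀ hp₀).2
  have j1 := abs_le.1 (hJensen p₁ hp₁).2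
  have j2 := abs_le.1 (hJensen p₂ hp₂).2
  -- The lower bound uses `p₁` and tests the upper transform with `p₀`; the upper bound uses `p₂`
  -- and tests the lower one with `p₀`.
  have m1 := hmin₁ p₀ hp₀
  have m2 := hmin₂ p₀ hp₀
  rw [abs_le]
  constructor <;> linarith [j0.1, j0.2, j1.1, j1.2, j2.1, j2.2]
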